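/- Let $\mathbb F=\mathbb R$ or $\mathbb C$, let $n\ge 0$, let $G^n$ be the set of all linear subspaces of $\mathbb F^n$, and let $\mathbb{FP}^{n-1}$ be the set of lines of $\mathbb F^n$ (empty if $n=0$) with the angular (Fubini–Study) distance $\cos^{-1}\frac{|\langle v,w\rangle|}{\|v\|\|w\|}$ between the lines spanned by $v$ and $w$. For subspaces $V,W$ of $\mathbb F^n$ of dimensions $p$ and $q$ with $p\le q$, let $0\le\theta_1\le\dots\le\theta_p\le\frac\pi2$ be their principal angles (their cosines are the first $p$ singular values, in decreasing order, of the orthogonal projection $V\to W$). Let $d$ be any of the following nine asymmetric metrics on $G^n$, where the first expression is $d(V,W)$ if $p\le q$ and the second one is $d(V,W)$ if $p>q$ (empty sums are $0$, empty products are $1$, and $\theta_p$ is read as $0$ if $p=0$): - $l^2$ metrics: $d_g$: $\sqrt{\sum_{i=1}^p\theta_i^2}$, $\frac\pi2\sqrt p$; $d_{cF}$: $2\sqrt{\sum_{i=1}^p\sin^2\frac{\theta_i}2}$, $\sqrt{2p}$; $d_{pF}$: $\sqrt{\sum_{i=1}^p\sin^2\theta_i}$, $\sqrt p$. - $\wedge$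 metrics: $d_{FS}$: $\cos^{-1}\bigl(\prod_{i=1}^p\cos\theta_i\bigr)$, $\frac\pi2$; $d_{c\wedge}$: $\sqrt{2-2\prod_{i=1}^p\cos\theta_i}$, $\sqrt2$; $d_{BC}$: $\sqrt{1-\prod_{i=1}^p\cos^2\theta_i}$, $1$. - max metrics: $d_A$: $\theta_p$, $\frac\pi2$; $d_{c2}$: $2\sin\frac{\theta_p}2$, $\sqrt2$; $d_{p2}$: $\sin\theta_p$, $1$. A bijection $f$ of $G^n$ is an isometry if $d(V,W)=d(f(V),f(W))$ for all $V,W$, and an anti-isometry if $d(V,W)=d(f(W),f(V))$ for all $V,W$. Let $\mathrm{Isom}(G^n)$ be the group of all isometries, $\mathrm{Transf}(G^n)$ the group of all isometries and anti-isometries, and $\mathrm{Isom}(\mathbb{FP}^{n-1})$ the group of bijective isometries of $\mathbb{FP}^{n-1}$. Let $\mathbf 1$ be the identity of $G^n$ and $\alpha(V)=V^\perp$. Then: 1. $\mathrm{Isom}(G^n)\cong\mathrm{Isom}(\mathbb{FP}^{n-1})$: every isometry of $G^n$ maps lines to lines, and restricting it to lines gives a group isomorphism. 2. If $d$ is a $\wedge$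 or max metric, $\mathrm{Transf}(G^n)\cong\mathrm{Isom}(\mathbb{FP}^{n-1})\rtimes\{\mathbf 1,\alpha\}$, by an isomorphism that sends $\mathbf 1$ and $\alpha$ to themselves and sends each $g\in\mathrm{Isom}(\mathbb{FP}^{n-1})$ to an isometry of $G^n$ that restricts to $g$ on lines. 3. If $d$ is an $l^2$ metric and $n\ge2$, $\mathrm{Transf}(G^n)\cong\mathrm{Isom}(\mathbb{FP}^{n-1})$, by restriction to lines. 4. If $d$ is an $l^2$ metric and $n=1$, $\mathrm{Transf}(G^n)=\{\mathbf 1,\alpha\}$. -/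

import Mathlib

open Module
open scoped LinearAlgebra.Projectivization

namespace TotalGrassmannian

/-! ### Isometries and anti-isometries of a set with a (possibly asymmetric) distance -/

/-- `f` preserves the distance `d`. -/
def IsIsometry {M : Type*} (d : M → M → ℝ) (f : Equiv.Perm M) : Prop :=
  ∀ x y, d x y = d (f x) (f y)

/-- `f` preserves the distance `d` up to exchanging the two arguments. -/
def IsAntiIsometry {M : Type*} (d : M → M → ℝ) (f : Equiv.Perm M) : Prop :=
  ∀ x y, d x y = d (f y) (f x)

/-- `Isom(M)`: the group of all bijective isometries of `(M, d)`. -/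
def isom {M : Type*} (d : M → M → ℝ) : Subgroup (Equiv.Perm M) where
  carrier := {f | IsIsometry d f}
  one_mem' := fun _ _ => rfl
  mul_mem' := fun {f g} hf hg x y => (hg x y).trans (hf (g x) (g y))
  inv_mem' := fun {f} hf x y => by
    have h := hf (f⁻¹ x) (f⁻¹ y)
    rw [show f (f⁻¹ x) = x from f.apply_symm_apply x,
      show f (f⁻¹ y) = y from f.apply_symm_apply y] at h
    exact h.symm

/-- `Transf(M)`: the group of all bijective isometries and anti-isometries of `(M, d)`. -/
def transf {M : Type*} (d : M → M → ℝ) : Subgroup (Equiv.Perm M) where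
  carrier := {f | IsIsometry d f ∨ IsAntiIsometry d f}
  one_mem' := Or.inl fun _ _ => rfl
  mul_mem' := fun {f g} hf hg => by
    rcases hf with hf | hf <;> rcases hg with hg | hg
    · exact Or.inl fun x y => (hg x y).trans (hf (g x) (g y))
    · exact Or.inr fun x y => (hg x y).trans (hf (g y) (g x))
    · exact Or.inr fun x y => (hg x y).trans (hf (g x) (g y))
    · exact Or.inl fun x y => (hg x y).trans (hf (g y) (g x))
  inv_mem' := fun {f} hf => by
    rcases hf with hf | hf
    · refine Or.inl fun x y => ?_
      have h := hf (f⁻¹ x) (f⁻¹ y)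
      rw [show f (f⁻¹ x) = x from f.apply_symm_apply x,
        show f (f⁻¹ y) = y from f.apply_symm_apply y] at h
      exact h.symm
    · refine Or.inr fun x y => ?_
      have h := hf (f⁻¹ y) (f⁻¹ x)
      rw [show f (f⁻¹ x) = x from f.apply_symm_apply x,
        show f (f⁻¹ y) = y from f.apply_symm_apply y] at h
      exact h.symm

/-! ### The Total Grassmannian, projective space, and principal angles -/

/-- The Total Grassmannian `G^n` of all subspaces of `𝕜^n`. -/
abbrev TotalGr (𝕜 : Type*) [RCLike 𝕜] (n : ℕ) : Type _ :=
  Submodule 𝕜 (EuclideanSpace 𝕜 (Fin n))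

/-- The projective space of `𝕜^n`, whose points are the lines of `𝕜^n`. -/
abbrev ProjSpace (𝕜 : Type*) [RCLike 𝕜] (n : ℕ) : Type _ :=
  ℙ 𝕜 (EuclideanSpace 𝕜 (Fin n))

/-- The angular (Fubini-Study) distance between two lines: the angle in `[0, π/2]` whose cosine
is `|⟪v, w⟫| / (‖v‖ ‖w‖)` for nonzero vectors `v`, `w` of the lines. -/
noncomputable def fubiniStudy {𝕜 : Type*} [RCLike 𝕜] {n : ℕ} (K L : ProjSpace 𝕜 n) : ℝ :=
  Real.arccos (‖inner 𝕜 K.rep L.rep‖ / (‖K.rep‖ * ‖L.rep‖))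

/-- The principal angles `θ₁ ≤ θ₂ ≤ …` of `V` and `W`, indexed from `0`: `principalAngle V W i` is
`θ_{i+1}`. Their cosines are the singular values, in decreasing order, of the orthogonal
projection `V → W`. There are `min (dim V) (dim W)` principal angles; for larger indices the
value is `π / 2`. -/
noncomputable def principalAngle {𝕜 : Type*} [RCLike 𝕜] {n : ℕ} (V W : TotalGr 𝕜 n) (i : ℕ) : ℝ :=
  Real.arccos (LinearMap.singularValues (𝕜 := 𝕜) (E := V) (F := W)
    (W.orthogonalProjectionOnto.toLinearMap ∘ₗ V.subtype) i)

/-! ### The asymmetric metrics -/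

/-- The nine types of metrics. -/
inductive MetricType
  | geodesic
  | chordalFrobenius
  | projectionFrobenius
  | fubiniStudy
  | chordalWedge
  | binetCauchy
  | asimov
  | chordalTwoNorm
  | projectionTwoNorm

/-- The `l²` metrics `d_g`, `d_cF`, `d_pF`. -/
def MetricType.IsL2 : MetricType → Prop
  | .geodesic | .chordalFrobenius | .projectionFrobenius => True
  | _ => False

/-- The `∧` metrics `d_FS`, `d_c∧`, `d_BC`. -/
def MetricType.IsWedge : MetricType → Prop
  | .fubiniStudy | .chordalWedge | .binetCauchy => True
  | _ => False

/-- The `max` metrics `d_A`, `d_c2`, `d_p2`. -/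
def MetricType.IsMax : MetricType → Prop
  | .asimov | .chordalTwoNorm | .projectionTwoNorm => True
  | _ => False

/-- The number `Δ_p`, for `p ≠ 0`: the diameter of the Grassmannian of `p`-subspaces. -/
noncomputable def MetricType.diam : MetricType → ℕ → ℝ
  | .geodesic, p => Real.pi / 2 * √p
  | .chordalFrobenius, p => √(2 * p)
  | .projectionFrobenius, p => √p
  | .fubiniStudy, _ => Real.pi / 2
  | .chordalWedge, _ => √2
  | .binetCauchy, _ => 1
  | .asimov, _ => Real.pi / 2
  | .chordalTwoNorm, _ => √2
  | .projectionTwoNorm, _ => 1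

/-- The largest of the first `p` terms of a nondecreasing sequence `θ 0 ≤ θ 1 ≤ …`,
to be read as `0` if `p = 0`. -/
def lastAngle (θ : ℕ → ℝ) : ℕ → ℝ
  | 0 => 0
  | p + 1 => θ p

/-- The distance as a function of the dimension `p` and the principal angles
`θ 0 ≤ … ≤ θ (p - 1)`. -/
noncomputable def MetricType.ofAngles : MetricType → ℕ → (ℕ → ℝ) → ℝ
  | .geodesic, p, θ => √(∑ i ∈ Finset.range p, θ i ^ 2)
  | .chordalFrobenius, p, θ => 2 * √(∑ i ∈ Finset.range p, Real.sin (θ i / 2) ^ 2)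
  | .projectionFrobenius, p, θ => √(∑ i ∈ Finset.range p, Real.sin (θ i) ^ 2)
  | .fubiniStudy, p, θ => Real.arccos (∏ i ∈ Finset.range p, Real.cos (θ i))
  | .chordalWedge, p, θ => √(2 - 2 * ∏ i ∈ Finset.range p, Real.cos (θ i))
  | .binetCauchy, p, θ => √(1 - ∏ i ∈ Finset.range p, Real.cos (θ i) ^ 2)
  | .asimov, p, θ => lastAngle θ p
  | .chordalTwoNorm, p, θ => 2 * Real.sin (lastAngle θ p / 2)
  | .projectionTwoNorm, p, θ => Real.sin (lastAngle θ p)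

open Classical in
/-- The asymmetric metric of type `m` on the Total Grassmannian: the function of the principal
angles given by `ofAngles` if `dim V ≤ dim W`, and `Δ_p` with `p = dim V` otherwise. -/
noncomputable def MetricType.asymDist (m : MetricType) {𝕜 : Type*} [RCLike 𝕜] {n : ℕ}
    (V W : TotalGr 𝕜 n) : ℝ :=
  if finrank 𝕜 V ≤ finrank 𝕜 W then m.ofAngles (finrank 𝕜 V) (principalAngle V W)
  else m.diam (finrank 𝕜 V)

/-! ### The orthogonal complement map -/

/-- The bijection `α(V) = V^⊥` of the Total Grassmannian. -/
noncomputable def perp (𝕜 : Type*) [RCLike 𝕜] (n : ℕ) : Equiv.Perm (TotalGr 𝕜 n) where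
  toFun V := Vᗮ
  invFun V := Vᗮ
  left_inv V := V.orthogonal_orthogonal
  right_inv V := V.orthogonal_orthogonal

theorem perp_mul_perp (𝕜 : Type*) [RCLike 𝕜] (n : ℕ) : perp 𝕜 n * perp 𝕜 n = 1 :=
  Equiv.ext fun V => V.orthogonal_orthogonal

/-- The group `{1, α}` of bijections of the Total Grassmannian. -/
noncomputable def perpGroup (𝕜 : Type*) [RCLike 𝕜] (n : ℕ) :
    Subgroup (Equiv.Perm (TotalGr 𝕜 n)) where
  carrier := {1, perp 𝕜 n}
  one_mem' := Or.inl rfl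
  mul_mem' := by
    rintro f g (rfl | rfl) (rfl | rfl)
    · exact Or.inl rfl
    · exact Or.inr rfl
    · exact Or.inr rfl
    · exact Or.inl (perp_mul_perp 𝕜 n)
  inv_mem' := by
    rintro f (rfl | rfl)
    · exact Or.inl inv_one
    · exact Or.inr (inv_eq_of_mul_eq_one_left (perp_mul_perp 𝕜 n))

/-- The bijection `f` of the Total Grassmannian maps lines to lines,
and it does so through the bijection `g` of the projective space. -/
def RestrictsTo {𝕜 : Type*} [RCLike 𝕜] {n : ℕ} (f : Equiv.Perm (TotalGr 𝕜 n))
    (g : Equiv.Perm (ProjSpace 𝕜 n)) : Prop :=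
  ∀ L : ProjSpace 𝕜 n, f L.submodule = (g L).submodule

end TotalGrassmannian

/-! ### Singular values and determinants -/

namespace LinearMap

variable {𝕜 : Type*} [RCLike 𝕜]
  {E : Type*} [NormedAddCommGroup E] [InnerProductSpace 𝕜 E] [FiniteDimensional 𝕜 E]
  {F : Type*} [NormedAddCommGroup F] [InnerProductSpace 𝕜 F] [FiniteDimensional 𝕜 F]

/-! The distance `d(V, W)` vanishes exactly when `V ≤ W` (`asymDist_eq_zero_iff`), so an isometry of
`G^n` is an order automorphism of the subspace lattice. It preserves dimension, which is height in
the lattice, hence permutes lines, and it is determined by its action on them. On lines each metric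
is an injective function of the angle, so the restriction is a Fubini–Study isometry.

Conversely, a Fubini–Study isometry `g` preserves orthogonality of lines, so by double orthogonal
complements `V ↦ span g(V)` adds no lines beyond the images of those of `V` (`map_le_extendFun_iff`)
and is an order automorphism. It preserves principal angles because Courant–Fischer expresses them
through inclusions, dimensions and angles between lines (`le_cosAngle_iff_lines`). No linear or
semilinear map inducing `g` is needed.

For `∧` and max metrics `α` is an anti-isometry: the product of cosines and the largest angle are
unchanged from `(V, W)` to `(W^⊥, V^⊥)`, by Sylvester's determinant identity and by a bound on inner
products between `V` and `W^⊥`. Composing with `α` turns anti-isometries into isometries, and `α`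
commutes with all extensions, so the semidirect product is direct. For `l²` metrics an anti-isometry
would force `Δ_1 = Δ_n`, impossible if `n ≥ 2`. -/

theorem norm_apply_sq_eq_sum_singularValues (T : E →ₗ[𝕜] F) (v : E) :
    ‖T v‖ ^ 2 = ∑ i : Fin (finrank 𝕜 E), T.singularValues i ^ 2 *
      ‖(T.isSymmetric_adjoint_comp_self.eigenvectorBasis rfl).repr v i‖ ^ 2 := by
  set b := T.isSymmetric_adjoint_comp_self.eigenvectorBasis rfl with hb
  have h : ((‖T v‖ ^ 2 : ℝ) : 𝕜) = inner 𝕜 v ((adjoint T ∘ₗ T) v) := by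
    change _ = inner 𝕜 v (adjoint T (T v))
    rw [adjoint_inner_right, inner_self_eq_norm_sq_to_K]
    push_cast; rfl
  rw [← b.repr.inner_map_map, PiLp.inner_apply] at h
  apply RCLike.ofReal_injective (K := 𝕜)
  rw [h]
  simp only [RCLike.ofReal_sum, RCLike.ofReal_mul, RCLike.ofReal_pow]
  refine Finset.sum_congr rfl fun i _ => ?_
  rw [hb, IsSymmetric.eigenvectorBasis_apply_self_apply, ← sq_singularValues_fin]
  rw [RCLike.inner_apply, mul_assoc, RCLike.mul_conj]
  push_cast; rfl

/-- Courant–Fischer: `c ≤ σ_k` iff `T` expands by at least `c` on some subspace of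
dimension `k + 1`. -/
theorem le_singularValues_iff (T : E →ₗ[𝕜] F) {c : ℝ} (hc : 0 < c) (k : ℕ) :
    c ≤ T.singularValues k ↔
      ∃ U : Submodule 𝕜 E, finrank 𝕜 U = k + 1 ∧ ∀ u ∈ U, c * ‖u‖ ≤ ‖T u‖ := by
  set b := T.isSymmetric_adjoint_comp_self.eigenvectorBasis rfl with hb
  have hspan (p : Fin (finrank 𝕜 E) → Prop) [DecidablePred p] :
      finrank 𝕜 (Submodule.span 𝕜 (Set.range fun i : {i // p i} => b i)) =
        Fintype.card {i // p i} :=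
    finrank_span_eq_card (b.orthonormal.linearIndependent.comp _ Subtype.val_injective)
  have hcoord (p : Fin (finrank 𝕜 E) → Prop) (v : E)
      (hv : v ∈ Submodule.span 𝕜 (Set.range fun i : {i // p i} => b i)) (j) (hj : ¬ p j) :
      b.repr v j = 0 := by
    induction hv using Submodule.span_induction with
    | mem x hx =>
      obtain ⟨i, rfl⟩ := hx
      have : j ≠ i := by rintro rfl; exact hj i.2
      simp [this]
    | zero => simp
    | add x y _ _ hx hy => simp [hx, hy]
    | smul a x _ hx => simp [hx]
  constructor
  · intro h
    -- Beyond the dimension singular values are 0 by default, which `0 < c` excludes.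
    have hk : k < finrank 𝕜 E := by
      by_contra! hk
      rw [T.singularValues_of_finrank_le hk] at h
      linarith
    -- The witness is the span of the eigenvectors of the `k + 1` largest singular values.
    refine ⟨_, (hspan fun i => i ≤ ⟨k, hk⟩).trans (by
      rw [Fintype.card_subtype]; simp [Finset.filter_ge_eq_Iic]), fun u hu => ?_⟩
    refine le_of_sq_le_sq ?_ (norm_nonneg _)
    rw [mul_pow, norm_apply_sq_eq_sum_singularValues, ← hb, ← b.repr.norm_map u,
      EuclideanSpace.norm_sq_eq, Finset.mul_sum]
    refine Finset.sum_le_sum fun i _ => ?_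
    by_cases hi : i ≤ ⟨k, hk⟩
    · gcongr
      exact h.trans (T.singularValues_antitone hi)
    · simp [hcoord _ u hu i hi]
  · rintro ⟨U, hU, hu⟩
    have hk : k < finrank 𝕜 E := by
      have := U.finrank_le
      omega
    set W := Submodule.span 𝕜 (Set.range fun i : {i : Fin (finrank 𝕜 E) // ⟨k, hk⟩ ≤ i} => b i)
      with hWdef
    have hW : finrank 𝕜 W = finrank 𝕜 E - k := by
      rw [hWdef, hspan, Fintype.card_subtype]
      simp [Finset.filter_le_eq_Ici]
    -- The dimensions `k + 1` and `finrank 𝕜 E - k` add up to more than that of `E`; on `W` the map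
    -- expands by at most `σ_k`.
    have hne : U ⊓ W ≠ ⊥ := by
      intro h
      have h1 := Submodule.finrank_add_finrank_le_of_disjoint (disjoint_iff.2 h)
      omega
    obtain ⟨v, ⟨hvU, hvW⟩, hv0⟩ := Submodule.exists_mem_ne_zero_of_ne_bot hne
    have h1 : ‖T v‖ ^ 2 ≤ (T.singularValues k * ‖v‖) ^ 2 := by
      rw [mul_pow, norm_apply_sq_eq_sum_singularValues, ← hb, ← b.repr.norm_map v,
        EuclideanSpace.norm_sq_eq, Finset.mul_sum]
      refine Finset.sum_le_sum fun i _ => ?_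
      by_cases hi : ⟨k, hk⟩ ≤ i
      · gcongr
        · exact T.singularValues_nonneg i
        · exact T.singularValues_antitone hi
      · simp [hcoord _ v hvW i hi]
    have h2 := le_of_sq_le_sq h1 (mul_nonneg (T.singularValues_nonneg k) (norm_nonneg v))
    exact le_of_mul_le_mul_right ((hu v hvU).trans h2) (norm_pos_iff.2 hv0)

theorem prod_singularValues_sq (T : E →ₗ[𝕜] F) :
    ((∏ i ∈ Finset.range (finrank 𝕜 E), T.singularValues i ^ 2 : ℝ) : 𝕜) =
      (adjoint T ∘ₗ T).det := by
  rw [T.isSymmetric_adjoint_comp_self.det_eq_prod_eigenvalues rfl, Finset.prod_range]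
  push_cast
  refine Finset.prod_congr rfl fun i _ => ?_
  rw [← sq_singularValues_fin]
  push_cast; rfl

/-- Sylvester's identity, transferred from matrices; `M` and `N` may have different dimensions. -/
theorem det_one_sub_comp_comm {R M N : Type*} [Field R] [AddCommGroup M] [Module R M]
    [FiniteDimensional R M] [AddCommGroup N] [Module R N] [FiniteDimensional R N]
    (A : M →ₗ[R] N) (B : N →ₗ[R] M) :
    LinearMap.det (LinearMap.id - B ∘ₗ A) = LinearMap.det (LinearMap.id - A ∘ₗ B) := by
  classical
  let b := finBasis R M
  let c := finBasis R N
  rw [← det_toMatrix b, ← det_toMatrix c, map_sub, map_sub, toMatrix_id, toMatrix_id,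
    toMatrix_comp b c b, toMatrix_comp c b c, Matrix.det_one_sub_mul_comm]

end LinearMap

/-! ### Cosines of principal angles -/

namespace TotalGrassmannian

variable {𝕜 : Type*} [RCLike 𝕜] {n : ℕ}

/-- The cosines of the principal angles, as singular values of the projection `V → W`. -/
noncomputable def cosAngle (V W : TotalGr 𝕜 n) (k : ℕ) : ℝ :=
  LinearMap.singularValues (𝕜 := 𝕜) (E := V) (F := W)
    (W.orthogonalProjectionOnto.toLinearMap ∘ₗ V.subtype) k

theorem cosAngle_nonneg (V W : TotalGr 𝕜 n) (k : ℕ) : 0 ≤ cosAngle V W k :=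
  LinearMap.singularValues_nonneg _ _

theorem cosAngle_antitone (V W : TotalGr 𝕜 n) : Antitone (cosAngle V W) :=
  LinearMap.singularValues_antitone (𝕜 := 𝕜) (E := V) (F := W) _

theorem le_cosAngle_iff (V W : TotalGr 𝕜 n) {c : ℝ} (hc : 0 < c) (k : ℕ) :
    c ≤ cosAngle V W k ↔ ∃ U ≤ V, finrank 𝕜 U = k + 1 ∧
      ∀ u ∈ U, c * ‖u‖ ≤ ‖W.orthogonalProjectionOnto u‖ := by
  refine (LinearMap.le_singularValues_iff (𝕜 := 𝕜) (E := V) (F := W) _ hc k).trans ?_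
  constructor
  · rintro ⟨U, hU, h⟩
    refine ⟨U.map V.subtype, Submodule.map_subtype_le V U, ?_, ?_⟩
    · rw [← hU]
      exact Submodule.finrank_map_subtype_eq V U
    · rintro _ ⟨u, hu, rfl⟩
      exact h u hu
  · rintro ⟨U, hUV, hU, h⟩
    refine ⟨U.comap V.subtype, ?_, fun u hu => h u hu⟩
    rw [← hU]
    exact (Submodule.comapSubtypeEquivOfLe hUV).finrank_eq

theorem cosAngle_le_one (V W : TotalGr 𝕜 n) (k : ℕ) :
    cosAngle V W k ≤ 1 := by
  by_contra! h
  obtain ⟨U, -, hU, hu⟩ := (le_cosAngle_iff V W (by linarith) k).1 le_rfl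
  obtain ⟨v, hv, hv0⟩ := Submodule.exists_mem_ne_zero_of_ne_bot
    (p := U) (by rintro rfl; simp at hU)
  have h1 := (hu v hv).trans (W.norm_orthogonalProjectionOnto_apply_le v)
  have h2 := norm_pos_iff.2 hv0
  nlinarith

theorem cos_principalAngle (V W : TotalGr 𝕜 n) (k : ℕ) :
    Real.cos (principalAngle V W k) = cosAngle V W k :=
  Real.cos_arccos (neg_one_lt_zero.le.trans (cosAngle_nonneg V W k))
    (cosAngle_le_one V W k)

theorem principalAngle_nonneg (V W : TotalGr 𝕜 n) (k : ℕ) : 0 ≤ principalAngle V W k :=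
  Real.arccos_nonneg _

theorem principalAngle_le (V W : TotalGr 𝕜 n) (k : ℕ) : principalAngle V W k ≤ Real.pi / 2 :=
  Real.arccos_le_pi_div_two.2 (cosAngle_nonneg V W k)

theorem principalAngle_mono (V W : TotalGr 𝕜 n) : Monotone (principalAngle V W) :=
  fun _ _ h => Real.arccos_le_arccos (cosAngle_antitone V W h)

/-! ### Lines -/

theorem norm_inner_eq_cos_fubiniStudy {K L : ProjSpace 𝕜 n} {v w : EuclideanSpace 𝕜 (Fin n)}
    (hv : v ∈ K.submodule) (hw : w ∈ L.submodule) :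
    ‖inner 𝕜 v w‖ = Real.cos (fubiniStudy K L) * (‖v‖ * ‖w‖) := by
  rw [Projectivization.submodule_eq, Submodule.mem_span_singleton] at hv hw
  obtain ⟨a, rfl⟩ := hv
  obtain ⟨b, rfl⟩ := hw
  have hK := norm_pos_iff.2 K.rep_nonzero
  have hL := norm_pos_iff.2 L.rep_nonzero
  have h1 := norm_inner_le_norm (𝕜 := 𝕜) K.rep L.rep
  have h2 : 0 ≤ ‖inner 𝕜 K.rep L.rep‖ / (‖K.rep‖ * ‖L.rep‖) := by positivity
  rw [fubiniStudy, Real.cos_arccos (by linarith) (by rw [div_le_one (by positivity)]; exact h1),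
    inner_smul_left, inner_smul_right, norm_smul, norm_smul, norm_mul, norm_mul, RCLike.norm_conj]
  field_simp

theorem fubiniStudy_nonneg (K L : ProjSpace 𝕜 n) : 0 ≤ fubiniStudy K L := Real.arccos_nonneg _

theorem fubiniStudy_le (K L : ProjSpace 𝕜 n) : fubiniStudy K L ≤ Real.pi / 2 :=
  Real.arccos_le_pi_div_two.2 (by positivity)

theorem submodule_mk_le_iff {v : EuclideanSpace 𝕜 (Fin n)} (hv : v ≠ 0) (V : TotalGr 𝕜 n) :
    (Projectivization.mk 𝕜 v hv).submodule ≤ V ↔ v ∈ V := by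
  rw [Projectivization.submodule_mk, Submodule.span_singleton_le_iff_mem]

theorem rep_mem (L : ProjSpace 𝕜 n) : L.rep ∈ L.submodule := by
  rw [Projectivization.submodule_eq]; exact Submodule.mem_span_singleton_self _

/-- A subspace is the union of its lines and 0, which lets inclusion and orthogonality be tested on
lines. -/
theorem le_iff_forall_line {V W : TotalGr 𝕜 n} :
    V ≤ W ↔ ∀ L : ProjSpace 𝕜 n, L.submodule ≤ V → L.submodule ≤ W := by
  refine ⟨fun h L hL => hL.trans h, fun h v hv => ?_⟩
  by_cases hv0 : v = 0
  · rw [hv0]; exact W.zero_mem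
  · exact (submodule_mk_le_iff hv0 W).1 (h _ ((submodule_mk_le_iff hv0 V).2 hv))

theorem ext_of_lines {V W : TotalGr 𝕜 n}
    (h : ∀ L : ProjSpace 𝕜 n, L.submodule ≤ V ↔ L.submodule ≤ W) : V = W :=
  le_antisymm (le_iff_forall_line.2 fun L => (h L).1) (le_iff_forall_line.2 fun L => (h L).2)

theorem isOrtho_submodule_iff {K L : ProjSpace 𝕜 n} :
    K.submodule ⟂ L.submodule ↔ fubiniStudy K L = Real.pi / 2 := by
  constructor
  · intro h
    have := norm_inner_eq_cos_fubiniStudy (rep_mem K) (rep_mem L)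
    rw [h.inner_eq (rep_mem K) (rep_mem L), norm_zero, eq_comm, mul_eq_zero] at this
    have h3 := this.resolve_right (by simp [K.rep_nonzero, L.rep_nonzero])
    apply Real.injOn_cos ⟨fubiniStudy_nonneg K L, by linarith [fubiniStudy_le K L, Real.pi_pos]⟩
      ⟨by positivity, by linarith [Real.pi_pos]⟩
    rw [h3, Real.cos_pi_div_two]
  · intro h
    rw [Submodule.isOrtho_iff_inner_eq]
    intro v hv w hw
    rw [← norm_eq_zero, norm_inner_eq_cos_fubiniStudy hv hw, h, Real.cos_pi_div_two, zero_mul]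

theorem isOrtho_iff_forall_line {V W : TotalGr 𝕜 n} :
    V ⟂ W ↔ ∀ K L : ProjSpace 𝕜 n, K.submodule ≤ V → L.submodule ≤ W →
      K.submodule ⟂ L.submodule := by
  refine ⟨fun h K L hK hL => h.mono hK hL, fun h => ?_⟩
  rw [Submodule.isOrtho_iff_le, le_iff_forall_line]
  intro K hK
  rw [← Submodule.isOrtho_iff_le, Submodule.isOrtho_comm, Submodule.isOrtho_iff_le,
    le_iff_forall_line]
  intro L hL
  exact (h K L hK hL).symm.le

/-- Among the lines of `W`, the closest to `L` is spanned by the projection of `L`, nonzero here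
because `0 < c`; the converse is Cauchy–Schwarz. -/
theorem le_norm_proj_iff {W : TotalGr 𝕜 n} {L : ProjSpace 𝕜 n} {c : ℝ} (hc : 0 < c) :
    (∀ u ∈ L.submodule, c * ‖u‖ ≤ ‖W.orthogonalProjectionOnto u‖) ↔
      ∃ K : ProjSpace 𝕜 n, K.submodule ≤ W ∧ c ≤ Real.cos (fubiniStudy L K) := by
  constructor
  · intro h
    have hu := h _ (rep_mem L)
    have hL := norm_pos_iff.2 L.rep_nonzero
    set w := W.orthogonalProjectionOnto L.rep with hw
    have hw0 : 0 < ‖(w : EuclideanSpace 𝕜 (Fin n))‖ := (by positivity : 0 < c * _).trans_le hu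
    have hw1 := norm_pos_iff.1 hw0
    refine ⟨_, (submodule_mk_le_iff hw1 W).2 w.2, ?_⟩
    have h1 := norm_inner_eq_cos_fubiniStudy (rep_mem L)
      ((submodule_mk_le_iff hw1 (Projectivization.mk 𝕜 _ hw1).submodule).1 le_rfl)
    have h2 : inner 𝕜 L.rep (w : EuclideanSpace 𝕜 (Fin n)) = inner 𝕜 w w := by
      rw [hw, W.inner_orthogonalProjectionOnto_eq_of_mem_right]
    rw [h2, inner_self_eq_norm_sq_to_K] at h1
    simp only [norm_pow, RCLike.norm_ofReal, abs_norm] at h1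
    change c * _ ≤ ‖(w : EuclideanSpace 𝕜 (Fin n))‖ at hu
    rw [Submodule.coe_norm, sq, ← mul_assoc] at h1
    have h3 := mul_right_cancel₀ hw0.ne' h1
    rw [h3] at hu
    exact le_of_mul_le_mul_right hu hL
  · rintro ⟨K, hK, h⟩ u hu
    have h1 := norm_inner_eq_cos_fubiniStudy hu (rep_mem K)
    have h2 := norm_inner_le_norm (𝕜 := 𝕜) (W.orthogonalProjectionOnto u)
      (⟨K.rep, hK (rep_mem K)⟩ : W)
    rw [W.inner_orthogonalProjectionOnto_eq_of_mem_right] at h2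
    change ‖inner 𝕜 u K.rep‖ ≤ _ * ‖K.rep‖ at h2
    rw [h1, ← mul_assoc] at h2
    have h3 := le_of_mul_le_mul_right h2 (norm_pos_iff.2 K.rep_nonzero)
    exact (mul_le_mul_of_nonneg_right h (norm_nonneg u)).trans h3

/-- Courant–Fischer without vectors: the right side is invariant under any order automorphism acting
isometrically on lines. -/
theorem le_cosAngle_iff_lines (V W : TotalGr 𝕜 n) {c : ℝ} (hc : 0 < c) (k : ℕ) :
    c ≤ cosAngle V W k ↔ ∃ U ≤ V, finrank 𝕜 U = k + 1 ∧
      ∀ L : ProjSpace 𝕜 n, L.submodule ≤ U →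
        ∃ K : ProjSpace 𝕜 n, K.submodule ≤ W ∧ c ≤ Real.cos (fubiniStudy L K) := by
  rw [le_cosAngle_iff V W hc]
  refine exists_congr fun U => and_congr_right fun _ => and_congr_right fun _ => ?_
  simp_rw [← le_norm_proj_iff hc]
  refine ⟨fun h L hL u hu => h u (hL hu), fun h u hu => ?_⟩
  by_cases hu0 : u = 0
  · simp [hu0]
  · exact h _ ((submodule_mk_le_iff hu0 U).2 hu) u ((submodule_mk_le_iff hu0 _).1 le_rfl)

theorem principalAngle_line (K L : ProjSpace 𝕜 n) :
    principalAngle K.submodule L.submodule 0 = fubiniStudy K L := by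
  have hL : ∀ L' : ProjSpace 𝕜 n, L'.submodule ≤ L.submodule ↔ L' = L := by
    refine fun L' => ⟨fun h => Projectivization.submodule_injective ?_, fun h => h ▸ le_rfl⟩
    exact Submodule.eq_of_le_of_finrank_eq h (by rw [L'.finrank_submodule, L.finrank_submodule])
  have h0 : 0 ≤ Real.cos (fubiniStudy K L) := Real.cos_nonneg_of_mem_Icc
    ⟨by linarith [fubiniStudy_nonneg K L, Real.pi_pos], fubiniStudy_le K L⟩
  have key : ∀ c : ℝ, 0 < c → (c ≤ cosAngle K.submodule L.submodule 0 ↔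
      c ≤ Real.cos (fubiniStudy K L)) := by
    intro c hc
    rw [le_cosAngle_iff _ _ hc]
    simp_rw [← show (∀ u ∈ K.submodule, c * ‖u‖ ≤ ‖L.submodule.orthogonalProjectionOnto u‖) ↔
      c ≤ Real.cos (fubiniStudy K L) by rw [le_norm_proj_iff hc]; simp [hL]]
    constructor
    · rintro ⟨U, hU, h1, h⟩
      rwa [Submodule.eq_of_le_of_finrank_eq hU (by rw [h1, K.finrank_submodule])] at h
    · exact fun h => ⟨_, le_rfl, K.finrank_submodule, h⟩
  have h : cosAngle K.submodule L.submodule 0 = Real.cos (fubiniStudy K L) := by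
    have h1 := cosAngle_nonneg K.submodule L.submodule 0
    apply le_antisymm
    · rcases h1.eq_or_lt with h1 | h1
      · rwa [← h1]
      · exact (key _ h1).1 le_rfl
    · rcases h0.eq_or_lt with h0 | h0
      · rwa [← h0]
      · exact (key _ h0).2 le_rfl
  change Real.arccos (cosAngle K.submodule L.submodule 0) = _
  rw [h, Real.arccos_cos (fubiniStudy_nonneg K L)]
  linarith [fubiniStudy_le K L, Real.pi_pos]

/-! ### Order automorphisms induced by isometries of the projective space -/

/-- Dimension is the height in the lattice of subspaces. -/
theorem finrank_orderIso (e : TotalGr 𝕜 n ≃o TotalGr 𝕜 n) (V : TotalGr 𝕜 n) :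
    finrank 𝕜 (e V) = finrank 𝕜 V := by
  have h (W : TotalGr 𝕜 n) : (finrank 𝕜 W : ℕ∞) = Order.height W := by
    rw [← Module.length_submodule, Module.length_eq_finrank]
  have := h (e V)
  rw [Order.height_orderIso, ← h V] at this
  exact_mod_cast this

theorem cosAngle_orderIso {e : TotalGr 𝕜 n ≃o TotalGr 𝕜 n} {g : Equiv.Perm (ProjSpace 𝕜 n)}
    (heg : RestrictsTo e.toEquiv g) (hg : IsIsometry fubiniStudy g) (V W : TotalGr 𝕜 n) (k : ℕ) :
    cosAngle (e V) (e W) k = cosAngle V W k := by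
  have heg' (L : ProjSpace 𝕜 n) : (g L).submodule = e L.submodule := (heg L).symm
  have key (c : ℝ) (hc : 0 < c) : c ≤ cosAngle (e V) (e W) k ↔ c ≤ cosAngle V W k := by
    rw [le_cosAngle_iff_lines _ _ hc, le_cosAngle_iff_lines _ _ hc]
    refine e.surjective.exists.trans (exists_congr fun U => ?_)
    rw [e.le_iff_le, finrank_orderIso]
    refine and_congr_right fun _ => and_congr_right fun _ =>
      g.surjective.forall.trans (forall_congr' fun L => ?_)
    rw [heg', e.le_iff_le]
    refine imp_congr_right fun _ => g.surjective.exists.trans (exists_congr fun K => ?_)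
    rw [heg', e.le_iff_le, ← hg L K]
  apply le_antisymm
  · rcases (cosAngle_nonneg (e V) (e W) k).eq_or_lt with h | h
    · exact h ▸ cosAngle_nonneg V W k
    · exact (key _ h).1 le_rfl
  · rcases (cosAngle_nonneg V W k).eq_or_lt with h | h
    · exact h ▸ cosAngle_nonneg (e V) (e W) k
    · exact (key _ h).2 le_rfl

theorem asymDist_orderIso (m : MetricType) {e : TotalGr 𝕜 n ≃o TotalGr 𝕜 n}
    {g : Equiv.Perm (ProjSpace 𝕜 n)}
    (heg : RestrictsTo e.toEquiv g) (hg : IsIsometry fubiniStudy g) :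
    IsIsometry m.asymDist e.toEquiv := by
  intro V W
  have h : principalAngle (e V) (e W) = principalAngle V W :=
    funext fun k => congrArg Real.arccos (cosAngle_orderIso heg hg V W k)
  simp only [MetricType.asymDist, OrderIso.coe_toEquiv, finrank_orderIso, h]

/-- The subspace spanned by the images of the lines of `V`. -/
noncomputable def extendFun (g : Equiv.Perm (ProjSpace 𝕜 n)) (V : TotalGr 𝕜 n) : TotalGr 𝕜 n :=
  ⨆ L : {L : ProjSpace 𝕜 n // L.submodule ≤ V}, (g L).submodule

theorem isOrtho_map_iff {g : Equiv.Perm (ProjSpace 𝕜 n)} (hg : IsIsometry fubiniStudy g)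
    (K L : ProjSpace 𝕜 n) :
    (g K).submodule ⟂ (g L).submodule ↔ K.submodule ⟂ L.submodule := by
  rw [isOrtho_submodule_iff, isOrtho_submodule_iff, hg K L]

/-- If a line `M` is orthogonal to `V`, then `g M` is orthogonal to all generators of `extendFun g
V`, hence to `g K`. Then `K ⟂ M`, and letting `M` vary puts `K` in `V^⊥⊥ = V`. -/
theorem map_le_extendFun_iff {g : Equiv.Perm (ProjSpace 𝕜 n)} (hg : IsIsometry fubiniStudy g)
    (V : TotalGr 𝕜 n) (K : ProjSpace 𝕜 n) :
    (g K).submodule ≤ extendFun g V ↔ K.submodule ≤ V := by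
  constructor
  · intro h
    rw [← V.orthogonal_orthogonal, ← Submodule.isOrtho_iff_le, isOrtho_iff_forall_line]
    intro K' M hK' hM
    have hM' : (g M).submodule ⟂ extendFun g V := by
      rw [Submodule.isOrtho_comm, extendFun, Submodule.isOrtho_iSup_left]
      rintro ⟨L, hL⟩
      rw [isOrtho_map_iff hg]
      exact (Submodule.isOrtho_orthogonal_right V).mono hL hM
    exact ((isOrtho_map_iff hg K M).1 (hM'.symm.mono_left h)).mono_left hK'
  · exact fun h => le_iSup
      (fun L : {L : ProjSpace 𝕜 n // L.submodule ≤ V} => (g L).submodule) ⟨K, h⟩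

theorem le_extendFun_iff {g : Equiv.Perm (ProjSpace 𝕜 n)} (hg : IsIsometry fubiniStudy g)
    (V : TotalGr 𝕜 n) (K : ProjSpace 𝕜 n) :
    K.submodule ≤ extendFun g V ↔ (g⁻¹ K).submodule ≤ V := by
  have h := map_le_extendFun_iff hg V (g⁻¹ K)
  rwa [show g (g⁻¹ K) = K from g.apply_symm_apply K] at h

theorem extendFun_mul {g h : Equiv.Perm (ProjSpace 𝕜 n)} (hg : IsIsometry fubiniStudy g)
    (hh : IsIsometry fubiniStudy h) (V : TotalGr 𝕜 n) :
    extendFun (g * h) V = extendFun g (extendFun h V) :=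
  ext_of_lines fun K => by
    rw [le_extendFun_iff ((isom fubiniStudy).mul_mem hg hh), le_extendFun_iff hg,
      le_extendFun_iff hh, mul_inv_rev, Equiv.Perm.mul_apply]

theorem extendFun_one (V : TotalGr 𝕜 n) : extendFun 1 V = V :=
  ext_of_lines fun K => by rw [le_extendFun_iff (isom fubiniStudy).one_mem, inv_one]; rfl

theorem extendFun_le_iff {g : Equiv.Perm (ProjSpace 𝕜 n)} (hg : IsIsometry fubiniStudy g)
    (V W : TotalGr 𝕜 n) : extendFun g V ≤ extendFun g W ↔ V ≤ W := by
  rw [le_iff_forall_line, le_iff_forall_line]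
  refine g.surjective.forall.trans (forall_congr' fun L => ?_)
  rw [map_le_extendFun_iff hg, map_le_extendFun_iff hg]

theorem extendFun_submodule {g : Equiv.Perm (ProjSpace 𝕜 n)} (hg : IsIsometry fubiniStudy g)
    (L : ProjSpace 𝕜 n) : extendFun g L.submodule = (g L).submodule := by
  have hle (K M : ProjSpace 𝕜 n) : K.submodule ≤ M.submodule ↔ K = M := by
    refine ⟨fun h => Projectivization.submodule_injective ?_, fun h => h ▸ le_rfl⟩
    exact Submodule.eq_of_le_of_finrank_eq h (by rw [K.finrank_submodule, M.finrank_submodule])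
  refine ext_of_lines fun K => ?_
  rw [le_extendFun_iff hg, hle, hle, Equiv.Perm.inv_eq_iff_eq, eq_comm]

/-- The order automorphism of the total Grassmannian induced by an isometry of the
projective space. -/
noncomputable def extend (g : isom (fubiniStudy (𝕜 := 𝕜) (n := n))) :
    TotalGr 𝕜 n ≃o TotalGr 𝕜 n where
  toFun := extendFun g
  invFun := extendFun (g⁻¹ : isom (fubiniStudy (𝕜 := 𝕜) (n := n)))
  left_inv V := by
    rw [← extendFun_mul (g⁻¹).2 g.2, ← Subgroup.coe_mul, inv_mul_cancel]
    exact extendFun_one V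
  right_inv V := by
    rw [← extendFun_mul g.2 (g⁻¹).2, ← Subgroup.coe_mul, mul_inv_cancel]
    exact extendFun_one V
  map_rel_iff' := extendFun_le_iff g.2 _ _

theorem extend_restrictsTo (g : isom (fubiniStudy (𝕜 := 𝕜) (n := n))) :
    RestrictsTo (extend g).toEquiv g :=
  extendFun_submodule g.2

theorem eq_of_restrictsTo {e e' : TotalGr 𝕜 n ≃o TotalGr 𝕜 n} {g : Equiv.Perm (ProjSpace 𝕜 n)}
    (h : RestrictsTo e.toEquiv g) (h' : RestrictsTo e'.toEquiv g) : e = e' := by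
  refine OrderIso.ext (funext fun V => ext_of_lines fun K => ?_)
  obtain ⟨L, rfl⟩ := g.surjective K
  rw [← h L, OrderIso.coe_toEquiv, e.le_iff_le, ← e'.le_iff_le]
  exact (h L).symm ▸ (h' L).symm ▸ Iff.rfl

theorem orderIso_orthogonal {e : TotalGr 𝕜 n ≃o TotalGr 𝕜 n} {g : Equiv.Perm (ProjSpace 𝕜 n)}
    (heg : RestrictsTo e.toEquiv g) (hg : IsIsometry fubiniStudy g) (V : TotalGr 𝕜 n) :
    e Vᗮ = (e V)ᗮ := by
  have heg' (L : ProjSpace 𝕜 n) : (g L).submodule = e L.submodule := (heg L).symm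
  refine ext_of_lines fun K => ?_
  obtain ⟨L, rfl⟩ := g.surjective K
  rw [← Submodule.isOrtho_iff_le, heg', e.le_iff_le, ← Submodule.isOrtho_iff_le,
    isOrtho_iff_forall_line, isOrtho_iff_forall_line]
  refine Iff.symm (g.surjective.forall₂.trans (forall₂_congr fun K M => ?_))
  rw [isOrtho_map_iff hg, heg', heg', e.le_iff_le, e.le_iff_le]

/-- The permutation of lines induced by an order automorphism of the total Grassmannian. -/
noncomputable def restrictLines (e : TotalGr 𝕜 n ≃o TotalGr 𝕜 n) : Equiv.Perm (ProjSpace 𝕜 n) :=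
  (Projectivization.equivSubmodule 𝕜 _).trans
    ((e.toEquiv.subtypeEquiv fun V => by rw [OrderIso.coe_toEquiv, finrank_orderIso]).trans
      (Projectivization.equivSubmodule 𝕜 _).symm)

theorem restrictLines_restrictsTo (e : TotalGr 𝕜 n ≃o TotalGr 𝕜 n) :
    RestrictsTo e.toEquiv (restrictLines e) := by
  intro L
  have h : Projectivization.equivSubmodule 𝕜 _ (restrictLines e L) =
    e.toEquiv.subtypeEquiv (fun V => by rw [OrderIso.coe_toEquiv, finrank_orderIso])
      (Projectivization.equivSubmodule 𝕜 _ L) := by simp [restrictLines]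
  exact (congrArg Subtype.val h).symm

/-! ### Elementary properties of the nine metrics -/

theorem sqrt_sum_sq_eq_zero_iff (p : ℕ) (f : ℕ → ℝ) :
    √(∑ i ∈ Finset.range p, f i ^ 2) = 0 ↔ ∀ i < p, f i = 0 := by
  rw [Real.sqrt_eq_zero (Finset.sum_nonneg fun i _ => sq_nonneg _),
    Finset.sum_eq_zero_iff_of_nonneg fun i _ => sq_nonneg _]
  simp

theorem one_le_prod_iff (p : ℕ) (f : ℕ → ℝ) (h0 : ∀ i, 0 ≤ f i) (h1 : ∀ i, f i ≤ 1) :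
    1 ≤ ∏ i ∈ Finset.range p, f i ↔ ∀ i < p, f i = 1 := by
  constructor
  · intro h i hi
    refine le_antisymm (h1 i) (h.trans ?_)
    rw [← Finset.mul_prod_erase _ _ (Finset.mem_range.2 hi)]
    exact mul_le_of_le_one_right (h0 i) (Finset.prod_le_one (fun _ _ => h0 _) fun _ _ => h1 _)
  · intro h
    rw [Finset.prod_congr rfl fun i hi => h i (Finset.mem_range.1 hi)]
    simp

theorem sin_eq_zero_iff_of_mem {x : ℝ} (h0 : 0 ≤ x) (h1 : x ≤ Real.pi / 2) :
    Real.sin x = 0 ↔ x = 0 :=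
  Real.sin_eq_zero_iff_of_lt_of_lt (by linarith [Real.pi_pos]) (by linarith [Real.pi_pos])

theorem cos_eq_one_iff_of_mem {x : ℝ} (h0 : 0 ≤ x) (h1 : x ≤ Real.pi / 2) :
    Real.cos x = 1 ↔ x = 0 :=
  Real.cos_eq_one_iff_of_lt_of_lt (by linarith [Real.pi_pos]) (by linarith [Real.pi_pos])

theorem lastAngle_mem {θ : ℕ → ℝ} (h0 : ∀ i, 0 ≤ θ i) (h1 : ∀ i, θ i ≤ Real.pi / 2) (p : ℕ) :
    0 ≤ lastAngle θ p ∧ lastAngle θ p ≤ Real.pi / 2 := by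
  cases p with
  | zero => exact ⟨le_rfl, by simp only [lastAngle]; positivity⟩
  | succ p => exact ⟨h0 p, h1 p⟩

theorem lastAngle_eq_zero_iff {θ : ℕ → ℝ} (h0 : ∀ i, 0 ≤ θ i) (hθ : Monotone θ) (p : ℕ) :
    lastAngle θ p = 0 ↔ ∀ i < p, θ i = 0 := by
  cases p with
  | zero => simp [lastAngle]
  | succ p =>
    exact ⟨fun h i hi => le_antisymm ((hθ (Nat.le_of_lt_succ hi)).trans h.le) (h0 i),
      fun h => h p p.lt_succ_self⟩

theorem ofAngles_eq_zero_iff (m : MetricType) {θ : ℕ → ℝ} (h0 : ∀ i, 0 ≤ θ i)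
    (h1 : ∀ i, θ i ≤ Real.pi / 2) (hθ : Monotone θ) (p : ℕ) :
    m.ofAngles p θ = 0 ↔ ∀ i < p, θ i = 0 := by
  have hhalf {x : ℝ} (h0 : 0 ≤ x) (h1 : x ≤ Real.pi / 2) : Real.sin (x / 2) = 0 ↔ x = 0 := by
    rw [sin_eq_zero_iff_of_mem (by linarith) (by linarith)]
    constructor <;> intro h <;> linarith
  have hc0 (i) : 0 ≤ Real.cos (θ i) :=
    Real.cos_nonneg_of_mem_Icc ⟨by linarith [h0 i, Real.pi_pos], h1 i⟩
  have hprod := one_le_prod_iff p (fun i => Real.cos (θ i)) hc0 fun i => Real.cos_le_one _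
  simp_rw [cos_eq_one_iff_of_mem (h0 _) (h1 _)] at hprod
  have hl := lastAngle_mem h0 h1 p
  have hl' := lastAngle_eq_zero_iff h0 hθ p
  cases m with
  | geodesic => exact sqrt_sum_sq_eq_zero_iff p θ
  | chordalFrobenius =>
    simp only [MetricType.ofAngles, mul_eq_zero, OfNat.ofNat_ne_zero, false_or,
      sqrt_sum_sq_eq_zero_iff p fun i => Real.sin (θ i / 2)]
    exact forall₂_congr fun i _ => hhalf (h0 i) (h1 i)
  | projectionFrobenius =>
    simp only [MetricType.ofAngles, sqrt_sum_sq_eq_zero_iff p fun i => Real.sin (θ i)]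
    exact forall₂_congr fun i _ => sin_eq_zero_iff_of_mem (h0 i) (h1 i)
  | fubiniStudy => exact Real.arccos_eq_zero.trans hprod
  | chordalWedge =>
    rw [← hprod, MetricType.ofAngles, Real.sqrt_eq_zero']
    constructor <;> intro h <;> linarith
  | binetCauchy =>
    rw [MetricType.ofAngles, Real.sqrt_eq_zero', Finset.prod_pow, sub_nonpos, ← hprod]
    exact one_le_sq_iff₀ (Finset.prod_nonneg fun i _ => hc0 i)
  | asimov => exact hl'
  | chordalTwoNorm =>
    rw [MetricType.ofAngles, mul_eq_zero, hhalf hl.1 hl.2, hl']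
    simp
  | projectionTwoNorm => rw [MetricType.ofAngles, sin_eq_zero_iff_of_mem hl.1 hl.2, hl']

/-- Allows the Fubini–Study distance of two lines to be recovered from any of the nine metrics. -/
theorem ofAngles_one_injOn (m : MetricType) {x y : ℝ} (hx : x ∈ Set.Icc 0 (Real.pi / 2))
    (hy : y ∈ Set.Icc 0 (Real.pi / 2)) (h : m.ofAngles 1 (fun _ => x) = m.ofAngles 1 fun _ => y) :
    x = y := by
  have hcos {z : ℝ} (hz : z ∈ Set.Icc 0 (Real.pi / 2)) : 0 ≤ Real.cos z :=
    Real.cos_nonneg_of_mem_Icc ⟨by linarith [hz.1, Real.pi_pos], hz.2⟩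
  have hsin {z : ℝ} (hz : z ∈ Set.Icc 0 (Real.pi / 2)) : 0 ≤ Real.sin z :=
    Real.sin_nonneg_of_nonneg_of_le_pi hz.1 (by linarith [hz.2, Real.pi_pos])
  have half {z : ℝ} (hz : z ∈ Set.Icc 0 (Real.pi / 2)) : z / 2 ∈ Set.Icc 0 (Real.pi / 2) :=
    ⟨by linarith [hz.1], by linarith [hz.1, hz.2]⟩
  have hs {z w : ℝ} (hz : z ∈ Set.Icc 0 (Real.pi / 2)) (hw : w ∈ Set.Icc 0 (Real.pi / 2))
      (h : Real.sin z = Real.sin w) : z = w :=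
    Real.injOn_sin ⟨by linarith [hz.1, Real.pi_pos], hz.2⟩
      ⟨by linarith [hw.1, Real.pi_pos], hw.2⟩ h
  have hc (h : Real.cos x = Real.cos y) : x = y :=
    Real.injOn_cos ⟨hx.1, by linarith [hx.2, Real.pi_pos]⟩ ⟨hy.1, by linarith [hy.2, Real.pi_pos]⟩ h
  cases m with
  | geodesic =>
    simpa [MetricType.ofAngles, Real.sqrt_sq hx.1, Real.sqrt_sq hy.1] using h
  | chordalFrobenius =>
    simp only [MetricType.ofAngles, Finset.range_one, Finset.sum_singleton,
      Real.sqrt_sq (hsin (half hx)), Real.sqrt_sq (hsin (half hy))] at h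
    linarith [hs (half hx) (half hy) (by linarith)]
  | projectionFrobenius =>
    simp only [MetricType.ofAngles, Finset.range_one, Finset.sum_singleton,
      Real.sqrt_sq (hsin hx), Real.sqrt_sq (hsin hy)] at h
    exact hs hx hy h
  | fubiniStudy =>
    simp only [MetricType.ofAngles, Finset.range_one, Finset.prod_singleton] at h
    rwa [Real.arccos_cos hx.1 (by linarith [hx.2, Real.pi_pos]),
      Real.arccos_cos hy.1 (by linarith [hy.2, Real.pi_pos])] at h
  | chordalWedge =>
    simp only [MetricType.ofAngles, Finset.range_one, Finset.prod_singleton] at h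
    rw [Real.sqrt_inj (by linarith [Real.cos_le_one x]) (by linarith [Real.cos_le_one y])] at h
    exact hc (by linarith)
  | binetCauchy =>
    simp only [MetricType.ofAngles, Finset.range_one, Finset.prod_singleton] at h
    rw [← Real.sin_sq, ← Real.sin_sq, Real.sqrt_sq (hsin hx), Real.sqrt_sq (hsin hy)] at h
    exact hs hx hy h
  | asimov => exact h
  | chordalTwoNorm =>
    have h' : 2 * Real.sin (x / 2) = 2 * Real.sin (y / 2) := h
    linarith [hs (half hx) (half hy) (by linarith)]
  | projectionTwoNorm => exact hs hx hy h

theorem diam_pos (m : MetricType) {p : ℕ} (hp : p ≠ 0) : 0 < m.diam p := by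
  have : 0 < (p : ℝ) := by exact_mod_cast Nat.pos_of_ne_zero hp
  cases m <;> simp only [MetricType.diam] <;> positivity

/-- The dependence of `Δ_p` on `p` is what rules out anti-isometries for `l²` metrics; for the
others `Δ_p` is constant. -/
theorem diam_injective {m : MetricType} (hm : m.IsL2) : Function.Injective m.diam := by
  intro p q h
  have key (h : √(p : ℝ) = √(q : ℝ)) : p = q := by
    rw [Real.sqrt_inj (by positivity) (by positivity)] at h
    exact_mod_cast h
  cases m <;> simp only [MetricType.IsL2] at hm
  · exact key (mul_left_cancel₀ (by positivity) h)
  · simp only [MetricType.diam] at h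
    rw [Real.sqrt_inj (by positivity) (by positivity)] at h
    exact_mod_cast mul_left_cancel₀ two_ne_zero h
  · exact key h

theorem diam_eq {m : MetricType} (hm : m.IsWedge ∨ m.IsMax) (p q : ℕ) : m.diam p = m.diam q := by
  cases m <;> simp only [MetricType.IsWedge, MetricType.IsMax, or_self] at hm <;> rfl

/-! ### Distances and inclusions -/

/-- All cosines are 1 exactly when projection to `W` preserves norms on `V`. -/
theorem forall_principalAngle_eq_zero_iff (V W : TotalGr 𝕜 n) :
    (∀ i < finrank 𝕜 V, principalAngle V W i = 0) ↔ V ≤ W := by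
  have h (i) : principalAngle V W i = 0 ↔ 1 ≤ cosAngle V W i := Real.arccos_eq_zero
  simp_rw [h, le_cosAngle_iff V W one_pos, one_mul]
  constructor
  · intro h v hv
    by_cases hV : finrank 𝕜 V = 0
    · rw [Submodule.finrank_eq_zero] at hV
      subst hV
      rw [(Submodule.mem_bot 𝕜).1 hv]
      exact W.zero_mem
    obtain ⟨U, hU, hUr, hu⟩ := h (finrank 𝕜 V - 1) (by omega)
    rw [Submodule.eq_of_le_of_finrank_eq hU (by omega)] at hu
    rw [W.mem_iff_norm_starProjection]
    exact le_antisymm (W.norm_orthogonalProjectionOnto_apply_le v) (hu v hv)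
  · intro hVW i hi
    -- The smallest cosine has index `finrank 𝕜 V - 1`, with `V` itself as test subspace; the others
    -- follow by antitonicity.
    obtain ⟨U, hU, hUr, hu⟩ : ∃ U ≤ V, finrank 𝕜 U = finrank 𝕜 V - 1 + 1 ∧
        ∀ u ∈ U, ‖u‖ ≤ ‖W.orthogonalProjectionOnto u‖ :=
      ⟨V, le_rfl, by omega, fun v hv => (W.norm_orthogonalProjectionOnto_apply (hVW hv)).ge⟩
    have h1 : 1 ≤ cosAngle V W (finrank 𝕜 V - 1) :=
      (le_cosAngle_iff V W one_pos _).2 ⟨U, hU, hUr, by simpa using hu⟩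
    simpa using (le_cosAngle_iff V W one_pos i).1 (h1.trans (cosAngle_antitone V W (by omega)))

theorem asymDist_eq_zero_iff (m : MetricType) (V W : TotalGr 𝕜 n) :
    m.asymDist V W = 0 ↔ V ≤ W := by
  rw [MetricType.asymDist]
  split_ifs with h
  · rw [ofAngles_eq_zero_iff m (principalAngle_nonneg V W) (principalAngle_le V W)
      (principalAngle_mono V W), forall_principalAngle_eq_zero_iff]
  -- Here `dim V > dim W` makes `dim V` nonzero, avoiding `Δ_0`, which is 0 for `l²` metrics.
  · refine iff_of_false (diam_pos m (by omega)).ne' fun hVW => h (Submodule.finrank_mono hVW)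

theorem asymDist_of_finrank_lt (m : MetricType) {V W : TotalGr 𝕜 n}
    (h : finrank 𝕜 W < finrank 𝕜 V) : m.asymDist V W = m.diam (finrank 𝕜 V) :=
  if_neg h.not_ge

theorem ofAngles_congr (m : MetricType) {p : ℕ} {θ η : ℕ → ℝ} (h : ∀ i < p, θ i = η i) :
    m.ofAngles p θ = m.ofAngles p η := by
  have h' : ∀ i ∈ Finset.range p, θ i = η i := fun i hi => h i (Finset.mem_range.1 hi)
  have hl : lastAngle θ p = lastAngle η p := by
    cases p with
    | zero => rfl
    | succ p => exact h p p.lt_succ_self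
  cases m <;> simp only [MetricType.ofAngles, hl]
  all_goals first
    | rw [Finset.sum_congr rfl fun i hi => by rw [h' i hi]]
    | rw [Finset.prod_congr rfl fun i hi => by rw [h' i hi]]

theorem asymDist_line (m : MetricType) (K L : ProjSpace 𝕜 n) :
    m.asymDist K.submodule L.submodule = m.ofAngles 1 fun _ => fubiniStudy K L := by
  rw [MetricType.asymDist, if_pos (by rw [K.finrank_submodule, L.finrank_submodule]),
    K.finrank_submodule]
  refine ofAngles_congr m fun i hi => ?_
  rw [Nat.lt_one_iff.1 hi, principalAngle_line]

theorem isIsometry_of_restrictsTo {m : MetricType} {f : Equiv.Perm (TotalGr 𝕜 n)}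
    {g : Equiv.Perm (ProjSpace 𝕜 n)} (hf : IsIsometry m.asymDist f) (h : RestrictsTo f g) :
    IsIsometry fubiniStudy g := by
  intro K L
  have h1 := hf K.submodule L.submodule
  rw [h, h, asymDist_line, asymDist_line] at h1
  exact ofAngles_one_injOn m ⟨fubiniStudy_nonneg _ _, fubiniStudy_le _ _⟩
    ⟨fubiniStudy_nonneg _ _, fubiniStudy_le _ _⟩ h1

/-- An isometry of the total Grassmannian preserves inclusions. -/
def toOrderIso {m : MetricType} (f : isom (m.asymDist (𝕜 := 𝕜) (n := n))) :
    TotalGr 𝕜 n ≃o TotalGr 𝕜 n where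
  toEquiv := f
  map_rel_iff' {V W} := by
    rw [← asymDist_eq_zero_iff m, ← asymDist_eq_zero_iff m, ← f.2 V W]

/-! ### Extending isometries of the projective space -/

/-- Extension of isometries of the projective space to the total Grassmannian. -/
noncomputable def extendHom (m : MetricType) :
    isom (fubiniStudy (𝕜 := 𝕜) (n := n)) →* isom (m.asymDist (𝕜 := 𝕜) (n := n)) where
  toFun g := ⟨(extend g).toEquiv, asymDist_orderIso m (extend_restrictsTo g) g.2⟩
  map_one' := Subtype.ext (Equiv.ext extendFun_one)
  map_mul' g h := Subtype.ext (Equiv.ext (extendFun_mul g.2 h.2))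

theorem extendHom_restrictsTo (m : MetricType) (g : isom (fubiniStudy (𝕜 := 𝕜) (n := n))) :
    RestrictsTo (extendHom m g : Equiv.Perm (TotalGr 𝕜 n)) g :=
  extend_restrictsTo g

theorem extendHom_bijective (m : MetricType) :
    Function.Bijective (extendHom (𝕜 := 𝕜) (n := n) m) := by
  constructor
  · intro g h hgh
    refine Subtype.ext (Equiv.ext fun L => Projectivization.submodule_injective ?_)
    rw [← extendHom_restrictsTo m g, hgh, extendHom_restrictsTo m h]
  · intro f
    have h := restrictLines_restrictsTo (toOrderIso f)
    refine ⟨⟨restrictLines (toOrderIso f), isIsometry_of_restrictsTo f.2 h⟩, Subtype.ext ?_⟩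
    exact congrArg RelIso.toEquiv (eq_of_restrictsTo (e' := toOrderIso f)
      (extend_restrictsTo ⟨restrictLines (toOrderIso f), isIsometry_of_restrictsTo f.2 h⟩) h)

/-- Restriction to lines as an isomorphism of isometry groups. -/
noncomputable def restrictEquiv (m : MetricType) :
    isom (m.asymDist (𝕜 := 𝕜) (n := n)) ≃* isom (fubiniStudy (𝕜 := 𝕜) (n := n)) :=
  (MulEquiv.ofBijective (extendHom m) (extendHom_bijective m)).symm

theorem restrictEquiv_restrictsTo (m : MetricType) (f : isom (m.asymDist (𝕜 := 𝕜) (n := n))) :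
    RestrictsTo (f : Equiv.Perm (TotalGr 𝕜 n)) (restrictEquiv m f) := by
  have h := extendHom_restrictsTo m (restrictEquiv m f)
  rwa [show extendHom m (restrictEquiv m f) = f from
    (MulEquiv.ofBijective (extendHom m) (extendHom_bijective m)).apply_symm_apply f] at h

/-! ### Principal angles of orthogonal complements -/

/-- A lower bound on the projection to `W` is, by Pythagoras, an upper bound on the projection to
`W^⊥`. The resulting condition is symmetric in `V` and `W^⊥`, which gives `lastAngle_orthogonal`. -/
theorem le_cos_lastAngle_iff (V W : TotalGr 𝕜 n) {c : ℝ} (hc : 0 < c) (hc1 : c ≤ 1) :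
    c ≤ Real.cos (lastAngle (principalAngle V W) (finrank 𝕜 V)) ↔
      ∀ v ∈ V, ∀ w ∈ Wᗮ, ‖inner 𝕜 v w‖ ≤ √(1 - c ^ 2) * (‖v‖ * ‖w‖) := by
  have h1 : c ≤ Real.cos (lastAngle (principalAngle V W) (finrank 𝕜 V)) ↔
      ∀ v ∈ V, c * ‖v‖ ≤ ‖W.orthogonalProjectionOnto v‖ := by
    rcases hV : finrank 𝕜 V with _ | p
    -- For `V = ⊥` the last angle is 0 by convention, so the left side reads `c ≤ 1`.
    · rw [Submodule.finrank_eq_zero] at hV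
      subst hV
      simp [lastAngle, hc1]
    · change c ≤ Real.cos (principalAngle V W p) ↔ _
      rw [cos_principalAngle, le_cosAngle_iff V W hc]
      constructor
      · rintro ⟨U, hU, hUr, h⟩
        rwa [Submodule.eq_of_le_of_finrank_eq hU (by omega)] at h
      · exact fun h => ⟨V, le_rfl, hV, h⟩
  rw [h1]
  have hs : 0 ≤ 1 - c ^ 2 := by nlinarith
  have pyth (v : EuclideanSpace 𝕜 (Fin n)) :
      ‖v‖ ^ 2 = ‖W.orthogonalProjectionOnto v‖ ^ 2 + ‖Wᗮ.orthogonalProjectionOnto v‖ ^ 2 :=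
    W.norm_sq_eq_add_norm_sq_starProjection v
  have h2 (v : EuclideanSpace 𝕜 (Fin n)) : c * ‖v‖ ≤ ‖W.orthogonalProjectionOnto v‖ ↔
      ‖Wᗮ.orthogonalProjectionOnto v‖ ≤ √(1 - c ^ 2) * ‖v‖ := by
    rw [← sq_le_sq₀ (by positivity) (by positivity),
      ← sq_le_sq₀ (norm_nonneg _) (by positivity), mul_pow, mul_pow, Real.sq_sqrt hs]
    have := pyth v
    constructor <;> intro h <;> linarith
  simp_rw [h2]
  refine forall₂_congr fun v _ => ⟨fun h w hw => ?_, fun h => ?_⟩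
  · have h3 := norm_inner_le_norm (𝕜 := 𝕜) (Wᗮ.orthogonalProjectionOnto v) (⟨w, hw⟩ : Wᗮ)
    rw [Wᗮ.inner_orthogonalProjectionOnto_eq_of_mem_right] at h3
    change ‖inner 𝕜 v w‖ ≤ _ * ‖w‖ at h3
    rw [← mul_assoc]
    exact h3.trans (by gcongr)
  -- Testing against the projection of `v` to `W^⊥` makes the inner product its squared norm.
  · have h3 := h _ (Wᗮ.orthogonalProjectionOnto v).2
    rw [← Wᗮ.inner_orthogonalProjectionOnto_eq_of_mem_right, inner_self_eq_norm_sq_to_K] at h3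
    simp only [norm_pow, RCLike.norm_ofReal, abs_norm] at h3
    rw [Submodule.coe_norm, ← mul_assoc, sq] at h3
    rcases (norm_nonneg (Wᗮ.orthogonalProjectionOnto v)).eq_or_lt with h4 | h4
    · rw [← h4]; positivity
    · exact le_of_mul_le_mul_right h3 h4

theorem lastAngle_principalAngle_mem (V W : TotalGr 𝕜 n) (p : ℕ) :
    0 ≤ lastAngle (principalAngle V W) p ∧ lastAngle (principalAngle V W) p ≤ Real.pi / 2 :=
  lastAngle_mem (principalAngle_nonneg V W) (principalAngle_le V W) p

theorem lastAngle_orthogonal (V W : TotalGr 𝕜 n) :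
    lastAngle (principalAngle Wᗮ Vᗮ) (finrank 𝕜 (Wᗮ : TotalGr 𝕜 n)) =
      lastAngle (principalAngle V W) (finrank 𝕜 V) := by
  have hm (V W : TotalGr 𝕜 n) := lastAngle_principalAngle_mem V W (finrank 𝕜 V)
  have hcos (V W : TotalGr 𝕜 n) :
      0 ≤ Real.cos (lastAngle (principalAngle V W) (finrank 𝕜 V)) :=
    Real.cos_nonneg_of_mem_Icc ⟨by linarith [(hm V W).1, Real.pi_pos], (hm V W).2⟩
  have key (V W : TotalGr 𝕜 n) : Real.cos (lastAngle (principalAngle V W) (finrank 𝕜 V)) ≤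
      Real.cos (lastAngle (principalAngle Wᗮ Vᗮ) (finrank 𝕜 (Wᗮ : TotalGr 𝕜 n))) := by
    rcases (hcos V W).eq_or_lt with h | h
    · exact h ▸ hcos _ _
    · rw [le_cos_lastAngle_iff _ _ h (Real.cos_le_one _)]
      intro w hw v hv
      rw [V.orthogonal_orthogonal] at hv
      rw [norm_inner_symm, mul_comm ‖w‖]
      exact (le_cos_lastAngle_iff V W h (Real.cos_le_one _)).1 le_rfl v hv w hw
  have h' := key Wᗮ Vᗮ
  rw [V.orthogonal_orthogonal, W.orthogonal_orthogonal] at h'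
  refine Real.injOn_cos ⟨(hm _ _).1, ?_⟩ ⟨(hm _ _).1, ?_⟩ (le_antisymm h' (key V W))
  · linarith [(hm Wᗮ Vᗮ).2, Real.pi_pos]
  · linarith [(hm V W).2, Real.pi_pos]

/-- The orthogonal projection `V → W`. -/
noncomputable def proj (V W : TotalGr 𝕜 n) : V →ₗ[𝕜] W :=
  W.orthogonalProjectionOnto.toLinearMap ∘ₗ V.subtype

theorem adjoint_proj (V W : TotalGr 𝕜 n) :
    LinearMap.adjoint (𝕜 := 𝕜) (E := V) (F := W) (proj V W) = proj W V := by
  symm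
  refine (LinearMap.eq_adjoint_iff (𝕜 := 𝕜) (E := W) (F := V) _ _).2 fun w v => ?_
  exact (V.inner_orthogonalProjectionOnto_eq_of_mem_right v (w : EuclideanSpace 𝕜 (Fin n))).trans
    (W.inner_orthogonalProjectionOnto_eq_of_mem_left w (v : EuclideanSpace 𝕜 (Fin n))).symm

/-- Compress `1 = P_W + P_{W^⊥}` to `V`. -/
theorem id_sub_proj_comp_proj (V W : TotalGr 𝕜 n) :
    LinearMap.id - proj W V ∘ₗ proj V W = proj Wᗮ V ∘ₗ proj V Wᗮ := by
  refine LinearMap.ext fun v => ?_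
  have h := congrArg V.orthogonalProjectionOnto
    (W.starProjection_add_starProjection_orthogonal (v : EuclideanSpace 𝕜 (Fin n)))
  rw [map_add, V.orthogonalProjectionOnto_mem_subspace_eq_self] at h
  exact sub_eq_of_eq_add' h.symm

theorem prod_cos_sq_principalAngle (V W : TotalGr 𝕜 n) :
    ((∏ i ∈ Finset.range (finrank 𝕜 V), Real.cos (principalAngle V W i) ^ 2 : ℝ) : 𝕜) =
      (proj W V ∘ₗ proj V W).det := by
  have h := LinearMap.prod_singularValues_sq (𝕜 := 𝕜) (E := V) (F := W) (proj V W)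
  simp_rw [cos_principalAngle]
  exact h.trans (congrArg (fun A : W →ₗ[𝕜] V => (A ∘ₗ proj V W).det) (adjoint_proj V W))

/-- With `A : V → W^⊥` and `B : W^⊥ → V` the projections, the left side is `det (1 - A B)` on `W^⊥`
and the right side is `det (1 - B A)` on `V`. -/
theorem prod_cos_sq_orthogonal (V W : TotalGr 𝕜 n) :
    ∏ i ∈ Finset.range (finrank 𝕜 (Wᗮ : TotalGr 𝕜 n)), Real.cos (principalAngle Wᗮ Vᗮ i) ^ 2 =
      ∏ i ∈ Finset.range (finrank 𝕜 V), Real.cos (principalAngle V W i) ^ 2 := by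
  apply RCLike.ofReal_injective (K := 𝕜)
  rw [prod_cos_sq_principalAngle, prod_cos_sq_principalAngle, ← id_sub_proj_comp_proj Wᗮ V,
    LinearMap.det_one_sub_comp_comm, ← id_sub_proj_comp_proj V W, sub_sub_cancel]

theorem prod_cos_orthogonal (V W : TotalGr 𝕜 n) :
    ∏ i ∈ Finset.range (finrank 𝕜 (Wᗮ : TotalGr 𝕜 n)), Real.cos (principalAngle Wᗮ Vᗮ i) =
      ∏ i ∈ Finset.range (finrank 𝕜 V), Real.cos (principalAngle V W i) := by
  have h0 (V W : TotalGr 𝕜 n) (i) : 0 ≤ Real.cos (principalAngle V W i) :=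
    cos_principalAngle V W i ▸ cosAngle_nonneg V W i
  rw [← sq_eq_sq₀ (Finset.prod_nonneg fun i _ => h0 _ _ i) (Finset.prod_nonneg fun i _ => h0 _ _ i),
    ← Finset.prod_pow, ← Finset.prod_pow, prod_cos_sq_orthogonal]

theorem isAntiIsometry_perp {m : MetricType} (hm : m.IsWedge ∨ m.IsMax) :
    IsAntiIsometry (m.asymDist (𝕜 := 𝕜) (n := n)) (perp 𝕜 n) := by
  intro V W
  change _ = m.asymDist Wᗮ Vᗮ
  have hV := V.finrank_add_finrank_orthogonal
  have hW := W.finrank_add_finrank_orthogonal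
  by_cases h : finrank 𝕜 V ≤ finrank 𝕜 W
  · rw [MetricType.asymDist, MetricType.asymDist, if_pos h, if_pos (by omega)]
    cases m <;> simp only [MetricType.IsWedge, MetricType.IsMax, or_self] at hm <;>
      simp only [MetricType.ofAngles, prod_cos_orthogonal, prod_cos_sq_orthogonal,
        lastAngle_orthogonal]
  · rw [asymDist_of_finrank_lt m (by omega), asymDist_of_finrank_lt m (by omega)]
    exact diam_eq hm _ _

/-! ### Anti-isometries -/

theorem isom_le_transf {M : Type*} (d : M → M → ℝ) : isom d ≤ transf d := fun _ => Or.inl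

theorem perpGroup_le_transf {m : MetricType} (hm : m.IsWedge ∨ m.IsMax) :
    perpGroup 𝕜 n ≤ transf (m.asymDist (𝕜 := 𝕜) (n := n)) := by
  rintro _ (rfl | rfl)
  · exact one_mem _
  · exact Or.inr (isAntiIsometry_perp hm)

theorem commute_extendHom_perp (m : MetricType) (g : isom (fubiniStudy (𝕜 := 𝕜) (n := n))) :
    Commute (perp 𝕜 n) (extendHom m g : Equiv.Perm (TotalGr 𝕜 n)) :=
  Equiv.ext fun V => (orderIso_orthogonal (extend_restrictsTo g) g.2 V).symm

/-- An isometry fixes `⊥` while `α` sends it to `⊤`, so `α` is an isometry only if `n = 0`, where `α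
= 1`. -/
theorem eq_one_of_mem_perpGroup_of_isIsometry {m : MetricType} {a : Equiv.Perm (TotalGr 𝕜 n)}
    (ha : a ∈ perpGroup 𝕜 n) (h : IsIsometry m.asymDist a) : a = 1 := by
  rcases ha with rfl | rfl
  · rfl
  · have h1 : (⊤ : TotalGr 𝕜 n) = ⊥ := by
      have := (toOrderIso ⟨_, h⟩).map_bot
      rwa [show toOrderIso ⟨_, h⟩ (⊥ : TotalGr 𝕜 n) = ⊤ from Submodule.bot_orthogonal_eq_top]
        at this
    have := subsingleton_of_bot_eq_top h1.symm
    exact Subsingleton.elim _ _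

/-- The homomorphism `(g, a) ↦ extend g * a`. -/
noncomputable def semidirectHom {m : MetricType} (hm : m.IsWedge ∨ m.IsMax) :
    isom (fubiniStudy (𝕜 := 𝕜) (n := n)) ⋊[1] perpGroup 𝕜 n →*
      transf (m.asymDist (𝕜 := 𝕜) (n := n)) :=
  SemidirectProduct.lift ((Subgroup.inclusion (isom_le_transf _)).comp (extendHom m))
    (Subgroup.inclusion (perpGroup_le_transf hm)) fun a => MonoidHom.ext fun g => by
      refine Subtype.ext ?_
      have hc : Commute (a : Equiv.Perm (TotalGr 𝕜 n)) (extendHom m g) := by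
        obtain ⟨a, rfl | rfl⟩ := a
        · exact Commute.one_left _
        · exact commute_extendHom_perp m g
      exact (mul_inv_eq_of_eq_mul hc.eq).symm

theorem semidirectHom_inr {m : MetricType} (hm : m.IsWedge ∨ m.IsMax) (a : perpGroup 𝕜 n) :
    semidirectHom hm (SemidirectProduct.inr a) =
      Subgroup.inclusion (perpGroup_le_transf hm) a := by
  simp [semidirectHom]

theorem semidirectHom_bijective {m : MetricType} (hm : m.IsWedge ∨ m.IsMax) :
    Function.Bijective (semidirectHom (𝕜 := 𝕜) (n := n) hm) := by
  constructor
  · rw [injective_iff_map_eq_one]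
    rintro ⟨g, a⟩ h
    have h1 : (extendHom m g : Equiv.Perm (TotalGr 𝕜 n)) * a = 1 := congrArg Subtype.val h
    have h2 : (a : Equiv.Perm (TotalGr 𝕜 n)) = 1 := by
      refine eq_one_of_mem_perpGroup_of_isIsometry (m := m) a.2 ?_
      rw [← inv_eq_of_mul_eq_one_right h1]
      exact (isom m.asymDist).inv_mem (extendHom m g).2
    rw [h2, mul_one] at h1
    have h3 : g = 1 := (extendHom_bijective m).1 (by rw [map_one]; exact Subtype.ext h1)
    rw [h3, show a = 1 from Subtype.ext h2]
    rfl
  · have hsurj (f : Equiv.Perm (TotalGr 𝕜 n)) (hf : IsIsometry m.asymDist f) :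
        ∃ g : isom (fubiniStudy (𝕜 := 𝕜) (n := n)),
          (extendHom m g : Equiv.Perm (TotalGr 𝕜 n)) = f := by
      obtain ⟨g, hg⟩ := (extendHom_bijective m).2 ⟨f, hf⟩
      exact ⟨g, congrArg Subtype.val hg⟩
    rintro ⟨f, hf | hf⟩
    · obtain ⟨g, hg⟩ := hsurj f hf
      exact ⟨⟨g, 1⟩, Subtype.ext ((mul_one _).trans hg)⟩
    -- Two anti-isometries compose to an isometry, and `α` is an involution.
    · obtain ⟨g, hg⟩ := hsurj (f * perp 𝕜 n) fun V W =>
        (isAntiIsometry_perp hm V W).trans (hf _ _)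
      refine ⟨⟨g, ⟨perp 𝕜 n, Or.inr rfl⟩⟩, Subtype.ext ?_⟩
      change (extendHom m g : Equiv.Perm (TotalGr 𝕜 n)) * perp 𝕜 n = f
      rw [hg, mul_assoc, perp_mul_perp, mul_one]

/-- An anti-isometry `f` reverses inclusions, so `f ⊥ = ⊤`. For a line `L`, `d(L, ⊥) = Δ_1` would
equal `d(⊤, f L) = Δ_n`. -/
theorem not_isAntiIsometry {m : MetricType} (hm : m.IsL2) (hn : 2 ≤ n)
    (f : Equiv.Perm (TotalGr 𝕜 n)) : ¬ IsAntiIsometry m.asymDist f := by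
  intro hf
  have hle (V W : TotalGr 𝕜 n) : V ≤ W ↔ f W ≤ f V := by
    rw [← asymDist_eq_zero_iff m, ← asymDist_eq_zero_iff m, hf V W]
  have hbot : f ⊥ = ⊤ := by
    rw [eq_top_iff, ← f.apply_symm_apply ⊤, ← hle]
    exact bot_le
  have : NeZero n := ⟨by omega⟩
  let v : EuclideanSpace 𝕜 (Fin n) := EuclideanSpace.single 0 1
  have hv : v ≠ 0 := by simp [v]
  let L : ProjSpace 𝕜 n := Projectivization.mk 𝕜 v hv
  have hL : L.submodule ≠ ⊥ := by
    intro h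
    have := L.finrank_submodule
    rw [h, finrank_bot] at this
    omega
  have hfL : f L.submodule < ⊤ := lt_top_iff_ne_top.2 fun h => hL (f.injective (h.trans hbot.symm))
  have h1 := hf L.submodule ⊥
  rw [hbot, asymDist_of_finrank_lt m (by rw [L.finrank_submodule, finrank_bot]; omega),
    asymDist_of_finrank_lt m (Submodule.finrank_lt_finrank_of_lt hfL), L.finrank_submodule,
    finrank_top, finrank_euclideanSpace_fin] at h1
  have := diam_injective hm h1
  omega

theorem transf_eq_isom {m : MetricType} (hm : m.IsL2) (hn : 2 ≤ n) :
    transf (m.asymDist (𝕜 := 𝕜) (n := n)) = isom m.asymDist :=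
  le_antisymm (fun f hf => hf.resolve_right (not_isAntiIsometry hm hn f)) (isom_le_transf _)

/-! ### The case `n = 1` -/

theorem eq_bot_or_eq_top_of_dim_one (V : TotalGr 𝕜 1) : V = ⊥ ∨ V = ⊤ := by
  have h := V.finrank_le
  rw [finrank_euclideanSpace_fin] at h
  rcases Nat.le_one_iff_eq_zero_or_eq_one.1 h with h | h
  · exact Or.inl (Submodule.finrank_eq_zero.1 h)
  · exact Or.inr (Submodule.eq_top_of_finrank_eq (by rw [h, finrank_euclideanSpace_fin]))

/-- With only `⊥` and `⊤` available, the only permutations are `1` and `α`. The only pair whose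
distance is nonzero is `(⊤, ⊥)`, which `α` with exchanged arguments maps to itself. -/
theorem transf_eq_perpGroup_of_dim_one (m : MetricType) :
    transf (m.asymDist (𝕜 := 𝕜) (n := 1)) = perpGroup 𝕜 1 := by
  have hbot : perp 𝕜 1 ⊥ = ⊤ := Submodule.bot_orthogonal_eq_top
  have htop : perp 𝕜 1 ⊤ = ⊥ := Submodule.top_orthogonal_eq_bot
  refine le_antisymm (fun f _ => ?_) ?_
  · rcases eq_bot_or_eq_top_of_dim_one (f ⊥) with h | h
    · have h' : f ⊤ = ⊤ := (eq_bot_or_eq_top_of_dim_one (f ⊤)).resolve_left fun h' =>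
        top_ne_bot (f.injective (h'.trans h.symm))
      refine Or.inl (Equiv.ext fun V => ?_)
      rcases eq_bot_or_eq_top_of_dim_one V with rfl | rfl
      exacts [h, h']
    · have h' : f ⊤ = ⊥ := (eq_bot_or_eq_top_of_dim_one (f ⊤)).resolve_right fun h' =>
        top_ne_bot (f.injective (h'.trans h.symm))
      refine Or.inr (Equiv.ext fun V => ?_)
      rcases eq_bot_or_eq_top_of_dim_one V with rfl | rfl
      exacts [h.trans hbot.symm, h'.trans htop.symm]
  · rintro _ (rfl | rfl)
    · exact one_mem _
    · refine Or.inr fun V W => ?_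
      have h0 {V W : TotalGr 𝕜 1} (h : V ≤ W) : m.asymDist V W = 0 :=
        (asymDist_eq_zero_iff m V W).2 h
      rcases eq_bot_or_eq_top_of_dim_one V with rfl | rfl <;>
        rcases eq_bot_or_eq_top_of_dim_one W with rfl | rfl <;>
        simp only [hbot, htop, h0 le_rfl, h0 bot_le]

end TotalGrassmannian

open TotalGrassmannian in
theorem proposition4p3 {𝕜 : Type*} [RCLike 𝕜] (n : ℕ) (m : MetricType) :
    -- `Isom(G^n) ≅ Isom(𝕜P^{n-1})`, by restriction to lines
    (∃ R : isom (m.asymDist (𝕜 := 𝕜) (n := n)) ≃* isom (fubiniStudy (𝕜 := 𝕜) (n := n)),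
      ∀ f : isom (m.asymDist (𝕜 := 𝕜) (n := n)),
        RestrictsTo (f : Equiv.Perm (TotalGr 𝕜 n)) (R f)) ∧
    -- `Transf(G^n) ≅ Isom(𝕜P^{n-1}) ⋊ {1, α}` for `∧` and `max` metrics
    (m.IsWedge ∨ m.IsMax →
      ∃ (φ : perpGroup 𝕜 n →* MulAut (isom (fubiniStudy (𝕜 := 𝕜) (n := n))))
        (e : isom (fubiniStudy (𝕜 := 𝕜) (n := n)) ⋊[φ] perpGroup 𝕜 n ≃*
          transf (m.asymDist (𝕜 := 𝕜) (n := n))),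
        (∀ a : perpGroup 𝕜 n,
          (e (SemidirectProduct.inr a) : Equiv.Perm (TotalGr 𝕜 n)) = a) ∧
        ∀ g : isom (fubiniStudy (𝕜 := 𝕜) (n := n)),
          IsIsometry m.asymDist (e (SemidirectProduct.inl g) : Equiv.Perm (TotalGr 𝕜 n)) ∧
          RestrictsTo (e (SemidirectProduct.inl g) : Equiv.Perm (TotalGr 𝕜 n)) g) ∧
    -- `Transf(G^n)` for `l²` metrics
    (m.IsL2 →
      (2 ≤ n →
        ∃ R : transf (m.asymDist (𝕜 := 𝕜) (n := n)) ≃* isom (fubiniStudy (𝕜 := 𝕜) (n := n)),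
          ∀ f : transf (m.asymDist (𝕜 := 𝕜) (n := n)),
            RestrictsTo (f : Equiv.Perm (TotalGr 𝕜 n)) (R f)) ∧
      (n = 1 → transf (m.asymDist (𝕜 := 𝕜) (n := n)) = perpGroup 𝕜 n)) := by
  refine ⟨⟨restrictEquiv m, restrictEquiv_restrictsTo m⟩, fun hm => ?_, fun hm => ⟨fun hn => ?_, ?_⟩⟩
  -- The action is trivial because `α` commutes with every extended isometry.
  · exact ⟨1, MulEquiv.ofBijective (semidirectHom hm) (semidirectHom_bijective hm),
      fun a => congrArg Subtype.val (semidirectHom_inr hm a),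
      fun g => ⟨(extendHom m g).2, extendHom_restrictsTo m g⟩⟩
  · exact ⟨(MulEquiv.subgroupCongr (transf_eq_isom hm hn)).trans (restrictEquiv m),
      fun f => restrictEquiv_restrictsTo m (MulEquiv.subgroupCongr (transf_eq_isom hm hn) f)⟩
  · rintro rfl
    exact transf_eq_perpGroup_of_dim_one m
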